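/- Let $\Lambda$ be an Artin algebra (an algebra over a commutative artinian ring $R$ that is finitely generated as an $R$-module), let $\mathrm{mod}(\Lambda)$ be the class of finitely generated left $\Lambda$-modules, $\mathcal P$ the class of projective modules in $\mathrm{mod}(\Lambda)$, and let $\Omega M$ denote the kernel of the projective cover of $M$. Notation. For classes $\mathcal X,\mathcal Y\subseteq\mathrm{mod}(\Lambda)$ and $M\in\mathrm{mod}(\Lambda)$: - $\mathrm{pd}\,M$ is the projective dimension of $M$ (with $\mathrm{pd}\,0=0$), $\mathrm{fin.dim}(\mathcal X):=\sup\{\mathrm{pd}\,X : X\in\mathcal X,\ \mathrm{pd}\,X<\infty\}$, and $\mathrm{fin.dim}(\Lambda):=\mathrm{fin.dim}(\mathrm{mod}(\Lambda))$. - $\mathrm{resdim}_{\mathcal X}(M)$ is the least $m\ge 0$ such that there is an exact sequence $0\to X_m\to\cdots\to X_0\to M\to 0$ with all $X_i\in\mathcal X$ ($\infty$ if there is none); $\mathrm{resdim}_{\mathcal X}(\mathcal Y):=\sup_{Y\in\mathcal Y}\mathrm{resdim}_{\mathcal X}(Y)$ and $\mathcal X^\wedge:=\{M : \mathrm{resdim}_{\mathcal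 X}(M)<\infty\}$. - $\mathrm{id}_{\mathcal X}(M)$ is the least $m\ge 0$ such that $\mathrm{Ext}^j_\Lambda(X,M)=0$ for all $j>m$ and $X\in\mathcal X$ ($\infty$ if there is none); $\mathrm{id}_{\mathcal X}(\mathcal Y):=\sup_{Y\in\mathcal Y}\mathrm{id}_{\mathcal X}(Y)$ and $\mathrm{id}(\mathcal Y):=\mathrm{id}_{\mathrm{mod}(\Lambda)}(\mathcal Y)$. - $\Omega^n(\mathrm{mod}(\Lambda)):=\{\Omega^nM : M\in\mathrm{mod}(\Lambda)\}$. Let $K$ be the free abelian group on the isomorphism classes $[M]$, $M\in\mathrm{mod}(\Lambda)$, modulo the relations $[M]-[X]-[Y]$ for $M\simeq X\oplus Y$. For a class $\mathcal X$ closed under finite direct sums and direct summands let $\langle\mathcal X\rangle\subseteq K$ be the subgroup generated by the classes of the indecomposable modules in $\mathcal X\cup\mathcal P$; let $K_{\mathcal P}:=K/\langle\mathcal P\rangle$, let $\overline L$ be the endomorphism of $K_{\mathcal P}$ induced by $[M]\mapsto[\Omega M]$, and let $\overline{\langle X\rangle}$ be the image of $\langle\mathrm{add}\,X\rangle$ in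 $K_{\mathcal P}$. The Igusa-Todorov functions are $$\Phi(X):=\min\{k\ge 0 : \overline L \text{ restricts to an isomorphism } \overline L^m(\overline{\langle X\rangle})\to\overline L^{m+1}(\overline{\langle X\rangle}) \text{ for all } m\ge k\},$$ $$\Psi(X):=\Phi(X)+\mathrm{fin.dim}(\{Z : Z \text{ is a direct summand of } \Omega^{\Phi(X)}X\}).$$ Put $\Phi\mathrm{dim}(\mathcal X):=\sup_{X\in\mathcal X}\Phi(X)$, $\Psi\mathrm{dim}(\mathcal X):=\sup_{X\in\mathcal X}\Psi(X)$, $\Phi\mathrm{dim}(\Lambda):=\Phi\mathrm{dim}(\mathrm{mod}(\Lambda))$ and $\Psi\mathrm{dim}(\Lambda):=\Psi\mathrm{dim}(\mathrm{mod}(\Lambda))$. Theorem. Let $n$ be a non-negative integer and let $\mathcal D\subseteq\mathrm{mod}(\Lambda)$ be left saturated (closed under extensions, under kernels of epimorphisms between its objects and under direct summands, and containing $\mathcal P$) with $\Phi\mathrm{dim}(\mathcal D)=0$. Then: (a) $\mathrm{fin.dim}(\Lambda)\le\Phi\mathrm{dim}(\Lambda)\le\Psi\mathrm{dim}(\Lambda)\le\mathrm{resdim}_{\mathcal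 D}(\Omega^n(\mathrm{mod}(\Lambda)))+n$. (b) Let $\omega\subseteq\mathcal D$ be a class closed under direct summands that is $\mathcal D$-injective (that is, $\mathrm{id}_{\mathcal D}(\omega)=0$) and a relative cogenerator in $\mathcal D$ (for every $X\in\mathcal D$ there is an exact sequence $0\to X\to W\to X'\to 0$ with $W\in\omega$ and $X'\in\mathcal D$). If $\Omega^n(\mathrm{mod}(\Lambda))\subseteq\mathcal D^\wedge$, then $$\mathrm{fin.dim}(\Lambda)\le\Phi\mathrm{dim}(\Lambda)\le\Psi\mathrm{dim}(\Lambda)\le\mathrm{id}(\omega)+n.$$ All dimensions take values in $\mathbb N\cup\{\infty\}$. -/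

import Mathlib

open CategoryTheory

universe u

namespace ArtinAlg

noncomputable section

/-! ### Artin algebras

`FGModuleCat Λ` is the class `mod Λ` of finitely generated left `Λ`-modules; a class of modules is
a `Set (FGModuleCat Λ)`. -/

/-- `Λ` is an Artin algebra: for some commutative artinian ring `R` it is an `R`-algebra that is
finitely generated as an `R`-module. (Replacing `R` by its image in `Λ` one may take `R` in the
universe of `Λ`.) -/
class IsArtinAlgebra (Λ : Type u) [Ring Λ] : Prop where
  exists_base : ∃ (R : Type u) (_ : CommRing R) (_ : Algebra R Λ),
    IsArtinianRing R ∧ Module.Finite R Λ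

instance (Λ : Type u) [Ring Λ] [h : IsArtinAlgebra Λ] : IsArtinianRing Λ := by
  obtain ⟨R, _, _, _, _⟩ := h.exists_base
  exact isArtinian_of_tower R inferInstance

variable {Λ : Type u} [Ring Λ]

/-! ### Classes of modules -/

/-- `Z` is (isomorphic to) a direct summand of `M`. -/
def IsSummand (Z M : FGModuleCat.{u} Λ) : Prop :=
  ∃ Z' : FGModuleCat.{u} Λ, Nonempty (M ≃ₗ[Λ] Z × Z')

/-- `add X`: the direct summands of the finite direct sums `X ^ s`. -/
def add (X : FGModuleCat.{u} Λ) : Set (FGModuleCat.{u} Λ) :=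
  {Z | ∃ s : ℕ, IsSummand Z (FGModuleCat.of Λ (Fin s → X))}

/-- `0 → A → B → C → 0` is exact. -/
structure IsShortExact {A B C : FGModuleCat.{u} Λ} (f : A →ₗ[Λ] B) (g : B →ₗ[Λ] C) : Prop where
  injective : Function.Injective f
  exact : Function.Exact f g
  surjective : Function.Surjective g

/-- The class of finitely generated projective modules. -/
def proj (Λ : Type u) [Ring Λ] : Set (FGModuleCat.{u} Λ) := {P | Module.Projective Λ P}

/-- Closed under direct summands (in particular under isomorphisms). -/
def ClosedUnderSummands (𝒳 : Set (FGModuleCat.{u} Λ)) : Prop :=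
  ∀ Z M : FGModuleCat.{u} Λ, M ∈ 𝒳 → IsSummand Z M → Z ∈ 𝒳

/-- Left saturated classes: closed under extensions, kernels of epimorphisms between objects of the
class and direct summands, and containing the projectives. -/
structure LeftSaturated (𝒟 : Set (FGModuleCat.{u} Λ)) : Prop where
  extensions : ∀ (A B C : FGModuleCat.{u} Λ) (f : A →ₗ[Λ] B) (g : B →ₗ[Λ] C),
    IsShortExact f g → A ∈ 𝒟 → C ∈ 𝒟 → B ∈ 𝒟
  kernels : ∀ (A B C : FGModuleCat.{u} Λ) (f : A →ₗ[Λ] B) (g : B →ₗ[Λ] C),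
    IsShortExact f g → B ∈ 𝒟 → C ∈ 𝒟 → A ∈ 𝒟
  projectives : proj Λ ⊆ 𝒟
  summands : ClosedUnderSummands 𝒟

/-- `ω` is a relative cogenerator in `𝒳`. -/
def IsRelCogenerator (𝒳 ω : Set (FGModuleCat.{u} Λ)) : Prop :=
  ω ⊆ 𝒳 ∧ ∀ X ∈ 𝒳, ∃ W ∈ ω, ∃ X' ∈ 𝒳, ∃ (f : X →ₗ[Λ] W) (g : W →ₗ[Λ] X'), IsShortExact f g

/-! ### Homological dimensions, with values in `ℕ∞` -/

/-- The relative injective dimension of `M` with respect to `𝒳`: the least `n` with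
`Ext^j(X, M) = 0` for all `j > n` and `X ∈ 𝒳`. -/
def relId (𝒳 : Set (FGModuleCat.{u} Λ)) (M : FGModuleCat.{u} Λ) : ℕ∞ :=
  ⨅ (n : ℕ) (_ : ∀ j : ℕ, n < j → ∀ X ∈ 𝒳, Subsingleton (Abelian.Ext X.obj M.obj j)), (n : ℕ∞)

/-- The relative injective dimension of a class. -/
def relIdClass (𝒳 𝒴 : Set (FGModuleCat.{u} Λ)) : ℕ∞ := ⨆ M ∈ 𝒴, relId 𝒳 M

/-- The injective dimension of a class of modules, i.e. the relative one with respect to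
`mod Λ`. -/
def idClass (𝒴 : Set (FGModuleCat.{u} Λ)) : ℕ∞ := relIdClass Set.univ 𝒴

/-- `ω` is `𝒳`-injective. -/
def IsRelInjective (𝒳 ω : Set (FGModuleCat.{u} Λ)) : Prop := relIdClass 𝒳 ω = 0

/-- The projective dimension (with `pd 0 = 0`). -/
def pd (M : FGModuleCat.{u} Λ) : ℕ∞ :=
  ⨅ (n : ℕ) (_ : HasProjectiveDimensionLE M.obj n), (n : ℕ∞)

/-- The finitistic dimension of a class: the supremum of the finite projective dimensions. -/
def finDim (𝒳 : Set (FGModuleCat.{u} Λ)) : ℕ∞ :=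
  ⨆ (M : FGModuleCat.{u} Λ) (_ : M ∈ 𝒳 ∧ pd M < ⊤), pd M

/-- `HasResolution 𝒳 n M`: there is an exact sequence `0 → X_n → ⋯ → X_1 → X_0 → M → 0` with all
`X_i ∈ 𝒳`, given by splitting it into short exact sequences. -/
inductive HasResolution (𝒳 : Set (FGModuleCat.{u} Λ)) : ℕ → FGModuleCat.{u} Λ → Prop
  | zero {X M : FGModuleCat.{u} Λ} (hX : X ∈ 𝒳) (e : X ≃ₗ[Λ] M) : HasResolution 𝒳 0 M
  | succ {n : ℕ} {K X M : FGModuleCat.{u} Λ} (f : K →ₗ[Λ] X) (g : X →ₗ[Λ] M)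
      (hfg : IsShortExact f g) (hX : X ∈ 𝒳) (hK : HasResolution 𝒳 n K) :
      HasResolution 𝒳 (n + 1) M

/-- The `𝒳`-resolution dimension of a module. -/
def resdim (𝒳 : Set (FGModuleCat.{u} Λ)) (M : FGModuleCat.{u} Λ) : ℕ∞ :=
  ⨅ (n : ℕ) (_ : HasResolution 𝒳 n M), (n : ℕ∞)

/-- The `𝒳`-resolution dimension of a class. -/
def resdimClass (𝒳 𝒴 : Set (FGModuleCat.{u} Λ)) : ℕ∞ := ⨆ M ∈ 𝒴, resdim 𝒳 M

/-- `𝒳^∧`: the modules of finite `𝒳`-resolution dimension. -/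
def wedge (𝒳 : Set (FGModuleCat.{u} Λ)) : Set (FGModuleCat.{u} Λ) := {M | resdim 𝒳 M < ⊤}

/-! ### Projective covers and syzygies -/

/-- `f : P → M` is a projective cover: `P` is projective, `f` is onto and its kernel is
superfluous. -/
structure IsProjectiveCover {P M : Type u} [AddCommGroup P] [Module Λ P] [AddCommGroup M]
    [Module Λ M] (f : P →ₗ[Λ] M) : Prop where
  projective : Module.Projective Λ P
  surjective : Function.Surjective f
  superfluous : ∀ N : Submodule Λ P, N ⊔ LinearMap.ker f = ⊤ → N = ⊤

theorem exists_projectiveCover [IsArtinianRing Λ] (M : FGModuleCat.{u} Λ) :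
    ∃ (P : FGModuleCat.{u} Λ) (f : P →ₗ[Λ] M), IsProjectiveCover f := by
  obtain ⟨k, p, hp⟩ := Module.Finite.exists_fin' Λ M
  obtain ⟨N, hN, hmin⟩ := WellFounded.has_min (wellFounded_lt (α := Submodule Λ (Fin k → Λ)))
    {N | N ⊔ LinearMap.ker p = ⊤} ⟨⊤, by simp⟩
  have hle : ∀ N' : Submodule Λ (Fin k → Λ), N' ≤ N → N' ⊔ LinearMap.ker p = ⊤ → N' = N := by
    intro N' h1 h2
    by_contra h3
    exact hmin N' h2 (lt_of_le_of_ne h1 h3)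
  have hsurj : Function.Surjective (p.comp N.subtype) := by
    intro m
    obtain ⟨x, rfl⟩ := hp m
    have hx : x ∈ N ⊔ LinearMap.ker p := by rw [hN]; trivial
    obtain ⟨y, hy, z, hz, rfl⟩ := Submodule.mem_sup.1 hx
    exact ⟨⟨y, hy⟩, by simp [LinearMap.mem_ker.1 hz]⟩
  -- a lift of `p` through `N`, which is onto by minimality
  obtain ⟨g, hg⟩ := Module.projective_lifting_property (p.comp N.subtype) p hsurj
  have hg' : ∀ x, p (g x) = p x := fun x => LinearMap.congr_fun hg x
  have key : ∀ S : Submodule Λ (Fin k → Λ), S ⊔ LinearMap.ker p = ⊤ →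
      S.map g = (⊤ : Submodule Λ N) := by
    intro S hS
    have : (S.map g).map N.subtype = N := by
      refine hle _ (Submodule.map_subtype_le _ _) ?_
      rw [eq_top_iff, ← hS]
      refine sup_le ?_ le_sup_right
      intro x hx
      have h1 : x = (g x : Fin k → Λ) + (x - g x) := by abel
      rw [h1]
      refine Submodule.add_mem_sup ⟨g x, ⟨x, hx, rfl⟩, rfl⟩ ?_
      simp [hg']
    apply Submodule.map_injective_of_injective N.injective_subtype
    rw [this, Submodule.map_subtype_top]
  have hgN : Function.Surjective (g.comp N.subtype) := by
    rw [← LinearMap.range_eq_top, LinearMap.range_comp, Submodule.range_subtype]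
    exact key N hN
  have hbij : Function.Bijective (g.comp N.subtype) :=
    ⟨IsNoetherian.injective_of_surjective_endomorphism _ hgN, hgN⟩
  let e := LinearEquiv.ofBijective _ hbij
  have hproj : Module.Projective Λ N := by
    refine Module.Projective.of_split (N.subtype.comp e.symm.toLinearMap) g ?_
    refine LinearMap.ext fun x => ?_
    exact e.apply_symm_apply x
  refine ⟨FGModuleCat.of Λ N, p.comp N.subtype, ⟨hproj, hsurj, ?_⟩⟩
  intro S hS
  apply Submodule.map_injective_of_injective N.injective_subtype
  rw [Submodule.map_subtype_top]
  refine hle _ (Submodule.map_subtype_le _ _) ?_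
  rw [eq_top_iff, ← hN]
  refine sup_le ?_ le_sup_right
  intro x hx
  have h2 : (⟨x, hx⟩ : N) ∈ S ⊔ LinearMap.ker (p.comp N.subtype) := by rw [hS]; trivial
  obtain ⟨s, hs, t, ht, hst⟩ := Submodule.mem_sup.1 h2
  have h3 : x = (s : Fin k → Λ) + t := (congrArg Subtype.val hst).symm
  rw [h3]
  exact Submodule.add_mem_sup ⟨s, hs, rfl⟩ (by simpa using ht)

/-- Projective covers are unique; hence so are their kernels. -/
theorem IsProjectiveCover.nonempty_ker_equiv {P Q M N : Type u}
    [AddCommGroup P] [Module Λ P] [AddCommGroup Q] [Module Λ Q]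
    [AddCommGroup M] [Module Λ M] [AddCommGroup N] [Module Λ N]
    {f : P →ₗ[Λ] M} {g : Q →ₗ[Λ] N} (hf : IsProjectiveCover f) (hg : IsProjectiveCover g)
    (e : M ≃ₗ[Λ] N) : Nonempty (LinearMap.ker f ≃ₗ[Λ] LinearMap.ker g) := by
  have := hf.projective
  have := hg.projective
  obtain ⟨a, ha⟩ := Module.projective_lifting_property g (e.toLinearMap.comp f) hg.surjective
  have ha' : ∀ x, g (a x) = e (f x) := fun x => LinearMap.congr_fun ha x
  have hasurj : Function.Surjective a := by
    rw [← LinearMap.range_eq_top]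
    apply hg.superfluous
    rw [eq_top_iff]
    intro y _
    obtain ⟨x, hx⟩ := hf.surjective (e.symm (g y))
    have h1 : y = a x + (y - a x) := by abel
    rw [h1]
    refine Submodule.add_mem_sup ⟨x, rfl⟩ ?_
    simp [ha', hx]
  obtain ⟨b, hb⟩ := Module.projective_lifting_property a LinearMap.id hasurj
  have hb' : ∀ y, a (b y) = y := fun y => LinearMap.congr_fun hb y
  have hbsurj : Function.Surjective b := by
    rw [← LinearMap.range_eq_top]
    apply hf.superfluous
    rw [eq_top_iff]
    intro x _
    have h1 : x = b (a x) + (x - b (a x)) := by abel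
    rw [h1]
    refine Submodule.add_mem_sup ⟨a x, rfl⟩ ?_
    rw [LinearMap.mem_ker]
    apply e.injective
    rw [← ha']
    simp [hb']
  have hainj : Function.Injective a := by
    intro x y hxy
    obtain ⟨x', rfl⟩ := hbsurj x
    obtain ⟨y', rfl⟩ := hbsurj y
    rw [hb', hb'] at hxy
    rw [hxy]
  let E : P ≃ₗ[Λ] Q := LinearEquiv.ofBijective a ⟨hainj, hasurj⟩
  have hE : (LinearMap.ker f).map E.toLinearMap = LinearMap.ker g := by
    ext y
    constructor
    · rintro ⟨x, hx, rfl⟩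
      change g (a x) = 0
      rw [ha', LinearMap.mem_ker.1 hx, map_zero]
    · intro hy
      obtain ⟨x, rfl⟩ := hasurj y
      refine ⟨x, ?_, rfl⟩
      apply e.injective
      rw [← ha', map_zero]
      exact hy
  exact ⟨(E.submoduleMap (LinearMap.ker f)).trans (LinearEquiv.ofEq _ _ hE)⟩

/-- The image of a superfluous submodule is superfluous. -/
theorem superfluous_map {P Q : Type u} [AddCommGroup P] [Module Λ P] [AddCommGroup Q] [Module Λ Q]
    (h : P →ₗ[Λ] Q) {K : Submodule Λ P} (hK : ∀ N : Submodule Λ P, N ⊔ K = ⊤ → N = ⊤)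
    (N : Submodule Λ Q) (hN : N ⊔ K.map h = ⊤) : N = ⊤ := by
  have h1 : N.comap h = ⊤ := by
    apply hK
    rw [eq_top_iff]
    intro x _
    have hx : h x ∈ N ⊔ K.map h := by rw [hN]; trivial
    obtain ⟨n, hn, _, ⟨k, hk, rfl⟩, hnk⟩ := Submodule.mem_sup.1 hx
    have h2 : x = (x - k) + k := by abel
    rw [h2]
    refine Submodule.add_mem_sup ?_ hk
    rw [Submodule.mem_comap, map_sub, ← hnk, add_sub_cancel_right]
    exact hn
  rw [eq_top_iff, ← hN]
  refine sup_le le_rfl ?_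
  rintro _ ⟨k, -, rfl⟩
  have : k ∈ N.comap h := by rw [h1]; trivial
  exact this

/-- The direct sum of two projective covers is a projective cover. -/
theorem IsProjectiveCover.prodMap {P Q M N : Type u}
    [AddCommGroup P] [Module Λ P] [AddCommGroup Q] [Module Λ Q]
    [AddCommGroup M] [Module Λ M] [AddCommGroup N] [Module Λ N]
    {f : P →ₗ[Λ] M} {g : Q →ₗ[Λ] N} (hf : IsProjectiveCover f) (hg : IsProjectiveCover g) :
    IsProjectiveCover (f.prodMap g) := by
  have := hf.projective
  have := hg.projective
  refine ⟨inferInstance, hf.surjective.prodMap hg.surjective, fun S hS => ?_⟩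
  apply superfluous_map (LinearMap.inl Λ P Q) hf.superfluous
  apply superfluous_map (LinearMap.inr Λ P Q) hg.superfluous
  rw [eq_top_iff, ← hS]
  refine sup_le (le_sup_left.trans le_sup_left) ?_
  rintro ⟨x, y⟩ hxy
  have hx : f x = 0 := congrArg Prod.fst (LinearMap.mem_ker.1 hxy)
  have hy : g y = 0 := congrArg Prod.snd (LinearMap.mem_ker.1 hxy)
  have h1 : ((x, y) : P × Q) = (x, 0) + (0, y) := by simp
  rw [h1]
  exact add_mem (Submodule.mem_sup_left (Submodule.mem_sup_right ⟨x, hx, rfl⟩))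
    (Submodule.mem_sup_right ⟨y, hy, rfl⟩)

/-- The kernel of `P × Q → M × N`. -/
def kerProdMapEquiv {P Q M N : Type u}
    [AddCommGroup P] [Module Λ P] [AddCommGroup Q] [Module Λ Q]
    [AddCommGroup M] [Module Λ M] [AddCommGroup N] [Module Λ N]
    (f : P →ₗ[Λ] M) (g : Q →ₗ[Λ] N) :
    LinearMap.ker (f.prodMap g) ≃ₗ[Λ] LinearMap.ker f × LinearMap.ker g where
  toFun z := (⟨z.1.1, congrArg Prod.fst (LinearMap.mem_ker.1 z.2)⟩,
    ⟨z.1.2, congrArg Prod.snd (LinearMap.mem_ker.1 z.2)⟩)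
  map_add' _ _ := rfl
  map_smul' _ _ := rfl
  invFun z := ⟨(z.1.1, z.2.1), Prod.ext z.1.2 z.2.2⟩
  left_inv _ := rfl
  right_inv _ := rfl

section Syzygy

variable [IsArtinianRing Λ]

/-- A projective cover of `M`. -/
def coverObj (M : FGModuleCat.{u} Λ) : FGModuleCat.{u} Λ := (exists_projectiveCover M).choose

/-- The projection of the projective cover of `M` onto `M`. -/
def coverMap (M : FGModuleCat.{u} Λ) : coverObj M →ₗ[Λ] M :=
  (exists_projectiveCover M).choose_spec.choose

theorem coverMap_spec (M : FGModuleCat.{u} Λ) : IsProjectiveCover (coverMap M) :=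
  (exists_projectiveCover M).choose_spec.choose_spec

/-- The syzygy `Ω M`: the kernel of the projective cover of `M`. -/
def syz (M : FGModuleCat.{u} Λ) : FGModuleCat.{u} Λ :=
  FGModuleCat.of Λ (LinearMap.ker (coverMap M))

theorem syz_congr {M N : FGModuleCat.{u} Λ} (e : M ≃ₗ[Λ] N) : Nonempty (syz M ≃ₗ[Λ] syz N) :=
  (coverMap_spec M).nonempty_ker_equiv (coverMap_spec N) e

theorem syz_prod {M X Y : FGModuleCat.{u} Λ} (e : M ≃ₗ[Λ] X × Y) :
    Nonempty (syz M ≃ₗ[Λ] syz X × syz Y) := by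
  obtain ⟨e'⟩ := (coverMap_spec M).nonempty_ker_equiv
    ((coverMap_spec X).prodMap (coverMap_spec Y)) e
  exact ⟨e'.trans (kerProdMapEquiv _ _)⟩

theorem syz_projective {P : FGModuleCat.{u} Λ} (hP : P ∈ proj Λ) : Subsingleton (syz P) := by
  have : Module.Projective Λ P := hP
  have hid : IsProjectiveCover (LinearMap.id : P →ₗ[Λ] P) :=
    ⟨this, Function.surjective_id, fun N hN => by simpa using hN⟩
  obtain ⟨e⟩ := (coverMap_spec P).nonempty_ker_equiv hid (LinearEquiv.refl Λ P)
  have : Subsingleton (LinearMap.ker (LinearMap.id : P →ₗ[Λ] P)) := by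
    rw [LinearMap.ker_id]; infer_instance
  exact e.toEquiv.subsingleton

end Syzygy

/-! ### The Igusa-Todorov functions -/

/-- Isomorphism of finitely generated modules. -/
def isoSetoid (Λ : Type u) [Ring Λ] : Setoid (FGModuleCat.{u} Λ) where
  r M N := Nonempty (M ≃ₗ[Λ] N)
  iseqv := ⟨fun M => ⟨LinearEquiv.refl Λ M⟩, fun ⟨e⟩ => ⟨e.symm⟩, fun ⟨e⟩ ⟨e'⟩ => ⟨e.trans e'⟩⟩

/-- The iso-classes of finitely generated modules. -/
abbrev IsoClass (Λ : Type u) [Ring Λ] : Type (u + 1) := Quotient (isoSetoid Λ)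

/-- The iso-class of `M`. -/
def isoClass (M : FGModuleCat.{u} Λ) : IsoClass Λ := Quotient.mk (isoSetoid Λ) M

/-- The relations `[M] - [X] - [Y]` for `M ≃ X ⊕ Y`. -/
def splitRelations (Λ : Type u) [Ring Λ] : AddSubgroup (FreeAbelianGroup (IsoClass Λ)) :=
  AddSubgroup.closure {k | ∃ M X Y : FGModuleCat.{u} Λ, Nonempty (M ≃ₗ[Λ] X × Y) ∧
    k = FreeAbelianGroup.of (isoClass M) - FreeAbelianGroup.of (isoClass X)
      - FreeAbelianGroup.of (isoClass Y)}

/-- `K`: the free abelian group on the iso-classes of finitely generated modules modulo the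
relations `[M] - [X] - [Y]` for `M ≃ X ⊕ Y`. -/
abbrev K (Λ : Type u) [Ring Λ] : Type (u + 1) :=
  FreeAbelianGroup (IsoClass Λ) ⧸ splitRelations Λ

/-- The class `[M]` of `M` in `K`. -/
def cls (M : FGModuleCat.{u} Λ) : K Λ :=
  QuotientAddGroup.mk (FreeAbelianGroup.of (isoClass M))

theorem cls_congr {M N : FGModuleCat.{u} Λ} (e : M ≃ₗ[Λ] N) : cls M = cls N :=
  congrArg (fun c => (QuotientAddGroup.mk (FreeAbelianGroup.of c) : K Λ))
    (Quotient.sound (s := isoSetoid Λ) ⟨e⟩)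

theorem cls_prod {M X Y : FGModuleCat.{u} Λ} (e : M ≃ₗ[Λ] X × Y) : cls M = cls X + cls Y := by
  have h : (FreeAbelianGroup.of (isoClass M) - FreeAbelianGroup.of (isoClass X)
      - FreeAbelianGroup.of (isoClass Y)) ∈ splitRelations Λ :=
    AddSubgroup.subset_closure ⟨M, X, Y, ⟨e⟩, rfl⟩
  have h' : cls M - cls X - cls Y = 0 := (QuotientAddGroup.eq_zero_iff _).2 h
  rw [sub_sub, sub_eq_zero] at h'
  exact h'

theorem cls_subsingleton (M : FGModuleCat.{u} Λ) [Subsingleton M] : cls M = 0 := by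
  have e : M ≃ₗ[Λ] M × M :=
    { toFun := fun x => (x, x)
      invFun := fun x => x.1
      map_add' := fun _ _ => rfl
      map_smul' := fun _ _ => rfl
      left_inv := fun _ => rfl
      right_inv := fun _ => Subsingleton.elim _ _ }
  simpa using cls_prod e

/-- `⟨𝒳⟩`: the subgroup of `K` generated by the classes of the indecomposable modules in `𝒳` and
of the indecomposable projective modules. -/
def span (𝒳 : Set (FGModuleCat.{u} Λ)) : AddSubgroup (K Λ) :=
  AddSubgroup.closure
    {k | ∃ M : FGModuleCat.{u} Λ, Indecomposable M.obj ∧ M ∈ 𝒳 ∪ proj Λ ∧ k = cls M}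

/-- `η_f(X)`: the least `k` such that `f` restricts to an isomorphism `f^m(X) → f^(m+1)(X)` for all
`m ≥ k`; it exists if `X` is finitely generated, by Fitting's lemma. -/
def eta {G : Type*} [AddCommGroup G] (f : G →+ G) (X : AddSubgroup G) : ℕ :=
  sInf {k | ∀ m, k ≤ m → Set.BijOn f (f^[m] '' X) (f^[m + 1] '' X)}

section IgusaTodorov

variable [IsArtinianRing Λ]

/-- The endomorphism `L` of `K` with `L [M] = [Ω M]`. -/
def L (Λ : Type u) [Ring Λ] [IsArtinianRing Λ] : K Λ →+ K Λ :=
  QuotientAddGroup.lift (splitRelations Λ)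
    (FreeAbelianGroup.lift (Quotient.lift (fun M => cls (syz M))
      (fun _ _ ⟨e⟩ => (syz_congr e).elim cls_congr)))
    (by
      refine (AddSubgroup.closure_le _).2 ?_
      rintro _ ⟨M, X, Y, ⟨e⟩, rfl⟩
      obtain ⟨e'⟩ := syz_prod e
      change FreeAbelianGroup.lift _ _ = 0
      rw [map_sub, map_sub, FreeAbelianGroup.lift_apply_of, FreeAbelianGroup.lift_apply_of,
        FreeAbelianGroup.lift_apply_of]
      change cls (syz M) - cls (syz X) - cls (syz Y) = 0
      rw [cls_prod e']
      abel)

theorem L_cls (M : FGModuleCat.{u} Λ) : L Λ (cls M) = cls (syz M) :=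
  FreeAbelianGroup.lift_apply_of _ _

theorem L_span_proj : span (proj Λ) ≤ (span (proj Λ)).comap (L Λ) := by
  nth_rewrite 1 [span]
  rw [AddSubgroup.closure_le]
  rintro _ ⟨P, -, hP, rfl⟩
  have := syz_projective (P := P) (by simpa using hP)
  change L Λ (cls P) ∈ span (proj Λ)
  rw [L_cls, cls_subsingleton]
  exact zero_mem _

/-- `K_𝒫 = K / ⟨𝒫⟩`, where `𝒫` is the class of projective modules. -/
abbrev KP (Λ : Type u) [Ring Λ] : Type (u + 1) := K Λ ⧸ span (proj Λ)

/-- The endomorphism of `K_𝒫` induced by `L`. -/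
def LP (Λ : Type u) [Ring Λ] [IsArtinianRing Λ] : KP Λ →+ KP Λ :=
  QuotientAddGroup.map (span (proj Λ)) (span (proj Λ)) (L Λ) L_span_proj

/-- The image of `⟨X⟩ = ⟨add X⟩` in `K_𝒫`. -/
def spanBar (X : FGModuleCat.{u} Λ) : AddSubgroup (KP Λ) :=
  (span (add X)).map (QuotientAddGroup.mk' (span (proj Λ)))

/-- The first Igusa-Todorov function `Φ`. -/
def phi (X : FGModuleCat.{u} Λ) : ℕ := eta (LP Λ) (spanBar X)

/-- The second Igusa-Todorov function: `Ψ(X) = Φ(X) + fin.dim {Z : Z | Ω^{Φ(X)} X}`. -/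
def psi (X : FGModuleCat.{u} Λ) : ℕ∞ := phi X + finDim {Z | IsSummand Z (syz^[phi X] X)}

/-- `Φdim(𝒳)`. -/
def phiDim (𝒳 : Set (FGModuleCat.{u} Λ)) : ℕ∞ := ⨆ X ∈ 𝒳, (phi X : ℕ∞)

/-- `Ψdim(𝒳)`. -/
def psiDim (𝒳 : Set (FGModuleCat.{u} Λ)) : ℕ∞ := ⨆ X ∈ 𝒳, psi X

end IgusaTodorov

/-- `mod Λ`, the class of all finitely generated left `Λ`-modules. -/
abbrev modCls (Λ : Type u) [Ring Λ] : Set (FGModuleCat.{u} Λ) := Set.univ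

end

end ArtinAlg

namespace ArtinAlg

variable {Λ : Type u} [Ring Λ]

/-! ### Direct summands -/

/-! Everything rests on one estimate: if `Ω^k M` lies in `𝒟`, then `Ψ(M) ≤ k`
(`LeftSaturated.psi_le`). Since `L` carries `⟨M⟩` into `⟨ΩM⟩`, passing to a syzygy lowers `Φ` by at
most one, so `Φ(M) ≤ Φ(Ω^k M) + k = k`. If `Z` is a summand of `Ω^{Φ(M)} M` with finite projective
dimension and `j = k - Φ(M)`, then `Ω^j Z` is a summand of `Ω^k M`, hence in `𝒟`. A module of finite
projective dimension with `Φ = 0` is projective, so `pd Z ≤ j`.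

That last fact is also the reason for `fin.dim ≤ Φdim`: a module is projective exactly when its
class in `K_𝒫` vanishes, and beyond step `Φ(M)` the map `L` is injective on the images of `⟨M⟩`; so
if some syzygy of `M` is projective, `Ω^{Φ(M)} M` already is.

It remains to put the syzygies of `N = Ω^n M` into `𝒟`. For (a), a `𝒟`-resolution of length `k`
gives `Ω^k N ∈ 𝒟`, because the modules with `i`-th syzygy in `𝒟` are closed under kernels of
epimorphisms. For (b), finite resolution dimension puts some high syzygy into `𝒟`, and one descends
to `Ω^k N` with `k = id(ω)`: if `ΩY ∈ 𝒟` and `Ext¹(Y, ω) = 0`, then `Y ∈ 𝒟`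
(`LeftSaturated.mem_of_syz_mem`). -/

theorem IsSummand.of_retract {Z M : FGModuleCat.{u} Λ} [IsNoetherianRing Λ]
    (i : Z →ₗ[Λ] M) (p : M →ₗ[Λ] Z) (h : p ∘ₗ i = LinearMap.id) : IsSummand Z M :=
  ⟨FGModuleCat.of Λ (LinearMap.ker p),
    ⟨((LinearMap.exact_subtype_ker_map p).splitSurjectiveEquiv
      (Submodule.subtype_injective _) ⟨i, h⟩).1.trans (LinearEquiv.prodComm Λ _ _)⟩⟩

theorem IsSummand.exists_retract {Z M : FGModuleCat.{u} Λ} (h : IsSummand Z M) :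
    ∃ (i : Z →ₗ[Λ] M) (p : M →ₗ[Λ] Z), p ∘ₗ i = LinearMap.id := by
  obtain ⟨Z', ⟨e⟩⟩ := h
  exact ⟨e.symm.toLinearMap ∘ₗ LinearMap.inl Λ Z Z', LinearMap.fst Λ Z Z' ∘ₗ e.toLinearMap,
    by ext; simp⟩

theorem IsSummand.of_equiv {Z M : FGModuleCat.{u} Λ} (e : Z ≃ₗ[Λ] M) : IsSummand Z M :=
  ⟨FGModuleCat.of Λ PUnit, ⟨e.symm.trans LinearEquiv.prodUnique.symm⟩⟩

theorem IsSummand.of_prod_left {M X Y : FGModuleCat.{u} Λ} (e : M ≃ₗ[Λ] X × Y) : IsSummand X M :=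
  ⟨Y, ⟨e⟩⟩

theorem IsSummand.of_prod_right {M X Y : FGModuleCat.{u} Λ} (e : M ≃ₗ[Λ] X × Y) :
    IsSummand Y M :=
  ⟨X, ⟨e.trans (LinearEquiv.prodComm Λ _ _)⟩⟩

theorem IsSummand.trans [IsNoetherianRing Λ] {X Y Z : FGModuleCat.{u} Λ} (h : IsSummand X Y)
    (h' : IsSummand Y Z) : IsSummand X Z := by
  obtain ⟨i, p, hp⟩ := h.exists_retract
  obtain ⟨j, q, hq⟩ := h'.exists_retract
  refine .of_retract (j ∘ₗ i) (p ∘ₗ q) (LinearMap.ext fun x => ?_)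
  have h1 : ∀ y, q (j y) = y := fun y => LinearMap.congr_fun hq y
  have h2 : ∀ y, p (i y) = y := fun y => LinearMap.congr_fun hp y
  simp [h1, h2]

theorem mem_add_of_isSummand [IsNoetherianRing Λ] {X Z : FGModuleCat.{u} Λ} (h : IsSummand Z X) :
    Z ∈ add X :=
  ⟨1, h.trans (.of_equiv (M := FGModuleCat.of Λ (Fin 1 → X))
    (LinearEquiv.funUnique (Fin 1) Λ X).symm)⟩

theorem proj_of_isSummand {Z P : FGModuleCat.{u} Λ} (h : IsSummand Z P) (hP : P ∈ proj Λ) :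
    Z ∈ proj Λ := by
  obtain ⟨i, p, hp⟩ := h.exists_retract
  have : Module.Projective Λ P := hP
  exact Module.Projective.of_split i p hp

theorem projective_obj_iff (M : FGModuleCat.{u} Λ) : Projective M.obj ↔ M ∈ proj Λ :=
  (IsProjective.iff_projective (R := Λ) (P := M)).symm

/-! ### Decomposition into indecomposable modules -/

/-- Summands of a finitely generated module are quotients of it, so biproduct decompositions among
all modules reduce to products of finitely generated ones. -/
theorem indecomposable_iff (M : FGModuleCat.{u} Λ) :
    Indecomposable M.obj ↔ Nontrivial M ∧ ∀ X Y : FGModuleCat.{u} Λ, (M ≃ₗ[Λ] X × Y) →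
      Subsingleton X ∨ Subsingleton Y := by
  rw [Indecomposable, ModuleCat.isZero_iff_subsingleton, not_subsingleton_iff_nontrivial]
  refine and_congr_right fun _ => ⟨fun h X Y e => ?_, fun h X Y e => ?_⟩
  · have := h X.obj Y.obj
      (LinearEquiv.toModuleIso (X₁ := M) (X₂ := X × Y) e ≪≫ (ModuleCat.biprodIsoProd X.obj Y.obj).symm)
    simpa only [ModuleCat.isZero_iff_subsingleton] using this
  · let e' : M ≃ₗ[Λ] X × Y := Iso.toLinearEquiv (X := M.obj) (Y := ModuleCat.of Λ (X × Y))
      (e ≪≫ ModuleCat.biprodIsoProd X Y)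
    have hX : Module.Finite Λ X := .of_surjective (LinearMap.fst Λ X Y ∘ₗ e'.toLinearMap)
      ((LinearMap.fst_surjective (R := Λ)).comp e'.surjective)
    have hY : Module.Finite Λ Y := .of_surjective (LinearMap.snd Λ X Y ∘ₗ e'.toLinearMap)
      ((LinearMap.snd_surjective (R := Λ)).comp e'.surjective)
    simpa only [ModuleCat.isZero_iff_subsingleton] using h ⟨X, hX⟩ ⟨Y, hY⟩ e'

/-- Strong induction on the length, which is finite and drops strictly in both factors of a
nontrivial decomposition. -/
theorem decomposition_induction [IsArtinianRing Λ] {p : FGModuleCat.{u} Λ → Prop}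
    (zero : ∀ M : FGModuleCat.{u} Λ, Subsingleton M → p M)
    (indec : ∀ M : FGModuleCat.{u} Λ, Indecomposable M.obj → p M)
    (prod : ∀ M X Y : FGModuleCat.{u} Λ, (M ≃ₗ[Λ] X × Y) → p X → p Y → p M)
    (M : FGModuleCat.{u} Λ) : p M := by
  suffices h : ∀ (l : ℕ∞) (M : FGModuleCat.{u} Λ), Module.length Λ M = l → p M from h _ M rfl
  intro l
  induction l using WellFoundedLT.induction with
  | ind l ih =>
    rintro M rfl
    rcases subsingleton_or_nontrivial M with h0 | h0
    · exact zero M h0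
    by_cases hM : Indecomposable M.obj
    · exact indec M hM
    rw [indecomposable_iff] at hM
    push Not at hM
    obtain ⟨X, Y, e, hX, hY⟩ := hM h0
    have hl : Module.length Λ M = Module.length Λ X + Module.length Λ Y := by
      rw [e.length_eq, Module.length_prod]
    have hX' : Module.length Λ X ≠ ⊤ := Module.length_ne_top
    have hY' : Module.length Λ Y ≠ ⊤ := Module.length_ne_top
    refine prod M X Y e (ih _ ?_ X rfl) (ih _ ?_ Y rfl)
    · rw [hl]
      simpa using (ENat.add_lt_add_iff_left hX').2 (Module.length_pos (R := Λ) (M := Y))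
    · rw [hl, add_comm]
      simpa using (ENat.add_lt_add_iff_left hY').2 (Module.length_pos (R := Λ) (M := X))

/-- Fitting's lemma. -/
theorem bijective_or_isNilpotent [IsArtinianRing Λ] {M : FGModuleCat.{u} Λ}
    (hM : Indecomposable M.obj) (f : Module.End Λ M) : Function.Bijective f ∨ IsNilpotent f := by
  -- For large `n` the module is the direct sum of kernel and range of `f ^ n`, so indecomposability
  -- kills one of them; `n > 0` is needed to pass from `f ^ n` invertible to `f` invertible.
  obtain ⟨n, hn, hpos⟩ :=
    (f.eventually_isCompl_ker_pow_range_pow.and (Filter.eventually_gt_atTop 0)).exists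
  have e := (Submodule.prodEquivOfIsCompl _ _ hn).symm
  rcases ((indecomposable_iff M).1 hM).2 (FGModuleCat.of Λ (LinearMap.ker (f ^ n)))
    (FGModuleCat.of Λ (LinearMap.range (f ^ n))) e with h | h
  · left
    have hbot : LinearMap.ker (f ^ n) = ⊥ := (Submodule.subsingleton_iff_eq_bot).1 h
    have htop : LinearMap.range (f ^ n) = ⊤ := by simpa [hbot] using hn.sup_eq_top
    have hu : IsUnit (f ^ n) :=
      (Module.End.isUnit_iff _).2 ⟨LinearMap.ker_eq_bot.1 hbot, LinearMap.range_eq_top.1 htop⟩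
    exact (Module.End.isUnit_iff _).1 ((isUnit_pow_iff hpos.ne').1 hu)
  · right
    exact ⟨n, LinearMap.range_eq_bot.1 ((Submodule.subsingleton_iff_eq_bot).1 h)⟩

/-- An indecomposable direct summand of a direct sum is a direct summand of one of the terms. -/
theorem IsSummand.left_or_right [IsArtinianRing Λ] {Z M X Y : FGModuleCat.{u} Λ}
    (hZ : Indecomposable Z.obj) (h : IsSummand Z M) (e : M ≃ₗ[Λ] X × Y) :
    IsSummand Z X ∨ IsSummand Z Y := by
  obtain ⟨i, p, hp⟩ := h.exists_retract
  let p' : X × Y →ₗ[Λ] Z := p ∘ₗ e.symm.toLinearMap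
  -- `a` and `b` are the endomorphisms of `Z` factoring through `X` and `Y`. They add up to the
  -- identity, so one of them is invertible by Fitting's lemma, and `Z` is a retract of the
  -- corresponding term.
  let a : Module.End Λ Z :=
    (p' ∘ₗ LinearMap.inl Λ X Y) ∘ₗ (LinearMap.fst Λ X Y ∘ₗ e.toLinearMap ∘ₗ i)
  let b : Module.End Λ Z :=
    (p' ∘ₗ LinearMap.inr Λ X Y) ∘ₗ (LinearMap.snd Λ X Y ∘ₗ e.toLinearMap ∘ₗ i)
  have hab : a + b = 1 := by
    refine LinearMap.ext fun z => ?_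
    have h1 : p' ((e (i z)).1, 0) + p' (0, (e (i z)).2) = z := by
      rw [← map_add]
      simpa [p'] using LinearMap.congr_fun hp z
    exact h1
  have key : ∀ (W : FGModuleCat.{u} Λ) (q : W →ₗ[Λ] Z) (j : Z →ₗ[Λ] W),
      IsUnit (q ∘ₗ j : Module.End Λ Z) → IsSummand Z W := by
    intro W q j ⟨w, hw⟩
    refine .of_retract j ((w⁻¹ : (Module.End Λ Z)ˣ).1 ∘ₗ q) ?_
    have := w.inv_mul
    rw [hw] at this
    exact this
  rcases bijective_or_isNilpotent hZ a with ha | ha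
  · exact .inl (key X _ _ ((Module.End.isUnit_iff a).2 ha))
  · refine .inr (key Y (p' ∘ₗ LinearMap.inr Λ X Y) (LinearMap.snd Λ X Y ∘ₗ e.toLinearMap ∘ₗ i) ?_)
    have hb : b = 1 - a := eq_sub_of_add_eq' hab
    change IsUnit b
    rw [hb]
    exact ha.isUnit_one_sub

theorem not_isSummand_of_subsingleton {Z M : FGModuleCat.{u} Λ} (hZ : Indecomposable Z.obj)
    [Subsingleton M] : ¬ IsSummand Z M := by
  intro h
  obtain ⟨i, p, hp⟩ := h.exists_retract
  have := ((indecomposable_iff Z).1 hZ).1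
  obtain ⟨z, hz⟩ := exists_ne (0 : Z)
  apply hz
  have h1 := LinearMap.congr_fun hp z
  rw [LinearMap.comp_apply, Subsingleton.elim (i z) 0, map_zero] at h1
  exact h1.symm

theorem isSummand_of_mem_add [IsArtinianRing Λ] {Z X : FGModuleCat.{u} Λ}
    (hZ : Indecomposable Z.obj) (h : Z ∈ add X) : IsSummand Z X := by
  obtain ⟨s, hs⟩ := h
  induction s with
  | zero => exact absurd hs (not_isSummand_of_subsingleton hZ)
  | succ s ih =>
    rcases hs.left_or_right (X := X) (Y := FGModuleCat.of Λ (Fin s → X)) hZ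
      (Fin.consLinearEquiv Λ (fun _ : Fin (s + 1) => (X : Type u))).symm with h | h
    · exact h
    · exact ih h

/-- A module has only finitely many indecomposable summands up to isomorphism. -/
theorem finite_cls_indecomposable_summands [IsArtinianRing Λ] (M : FGModuleCat.{u} Λ) :
    {k : K Λ | ∃ Z : FGModuleCat.{u} Λ, Indecomposable Z.obj ∧ IsSummand Z M ∧
      k = cls Z}.Finite := by
  induction M using decomposition_induction with
  | zero M hM =>
    convert Set.finite_empty
    rw [Set.eq_empty_iff_forall_notMem]
    rintro _ ⟨Z, hZ, hZM, -⟩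
    exact not_isSummand_of_subsingleton hZ hZM
  | indec M hM =>
    refine (Set.finite_singleton (cls M)).subset ?_
    rintro _ ⟨Z, hZ, ⟨Z', ⟨e⟩⟩, rfl⟩
    rcases ((indecomposable_iff M).1 hM).2 Z Z' e with h | h
    · have := ((indecomposable_iff Z).1 hZ).1
      exact absurd h (not_subsingleton Z)
    · rw [Set.mem_singleton_iff, cls_prod e, cls_subsingleton Z', add_zero]
  | prod M X Y e hX hY =>
    refine (hX.union hY).subset ?_
    rintro _ ⟨Z, hZ, hZM, rfl⟩
    exact (hZM.left_or_right hZ e).imp (fun h => ⟨Z, hZ, h, rfl⟩) (fun h => ⟨Z, hZ, h, rfl⟩)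

/-! ### Stabilization of an endomorphism on a finitely generated subgroup -/

section Eta

variable {G : Type*} [AddCommGroup G] (f : G →+ G)

/-- Surjectivity is automatic, so only the kernel of `f` on `f^m(X)` matters. -/
theorem bijOn_iterate_image_iff (X : AddSubgroup G) (m : ℕ) :
    Set.BijOn f (f^[m] '' X) (f^[m + 1] '' X) ↔ ∀ x ∈ X, f^[m + 1] x = 0 → f^[m] x = 0 := by
  constructor
  · intro h x hx h0
    rw [Function.iterate_succ_apply'] at h0
    refine h.injOn ⟨x, hx, rfl⟩ ⟨0, X.zero_mem, rfl⟩ ?_ |>.trans (iterate_map_zero f m)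
    rw [h0, iterate_map_zero, map_zero]
  · intro h
    refine ⟨?_, ?_, ?_⟩
    · rintro _ ⟨x, hx, rfl⟩
      exact ⟨x, hx, Function.iterate_succ_apply' f m x⟩
    · rintro _ ⟨x, hx, rfl⟩ _ ⟨y, hy, rfl⟩ hxy
      have := h (x - y) (X.sub_mem hx hy) (by
        rw [Function.iterate_succ_apply', iterate_map_sub, map_sub, hxy, sub_self])
      rwa [iterate_map_sub, sub_eq_zero] at this
    · rintro _ ⟨x, hx, rfl⟩
      exact ⟨f^[m] x, ⟨x, hx, rfl⟩, (Function.iterate_succ_apply' f m x).symm⟩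

/-- The kernels of the iterates form an ascending chain of subgroups of `Y`, which is Noetherian
over `ℤ`. -/
theorem exists_ker_iterate_stable {Y : AddSubgroup G} (hY : Y.FG) :
    ∃ k, ∀ m, k ≤ m → ∀ x ∈ Y, f^[m + 1] x = 0 → f^[m] x = 0 := by
  have hfg : (AddSubgroup.toIntSubmodule Y).FG := by
    rw [Submodule.fg_iff_addSubgroup_fg]
    exact hY
  have : Module.Finite ℤ (AddSubgroup.toIntSubmodule Y) := Module.Finite.iff_fg.2 hfg
  let c : ℕ →o Submodule ℤ (AddSubgroup.toIntSubmodule Y) :=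
    { toFun := fun n => AddSubgroup.toIntSubmodule
        { carrier := {y | f^[n] y.1 = 0}
          zero_mem' := iterate_map_zero f n
          add_mem' := fun {a b} ha hb => by
            change f^[n] (a.1 + b.1) = 0
            rw [iterate_map_add, show f^[n] a.1 = 0 from ha, show f^[n] b.1 = 0 from hb, add_zero]
          neg_mem' := fun {a} ha => by
            change f^[n] (-a.1) = 0
            rw [iterate_map_neg, show f^[n] a.1 = 0 from ha, neg_zero] }
      monotone' := by
        refine monotone_nat_of_le_succ fun n y hy => ?_
        change f^[n + 1] y.1 = 0
        rw [Function.iterate_succ_apply', show f^[n] y.1 = 0 from hy, map_zero] }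
  obtain ⟨k, hk⟩ := monotone_stabilizes_iff_noetherian.2
    (inferInstance : IsNoetherian ℤ (AddSubgroup.toIntSubmodule Y)) c
  refine ⟨k, fun m hm x hx h0 => ?_⟩
  have h1 : (⟨x, hx⟩ : AddSubgroup.toIntSubmodule Y) ∈ c (m + 1) := h0
  rw [← hk (m + 1) (by lia), hk m hm] at h1
  exact h1

/-- Finite generation makes the set under `sInf` nonempty; without it the junk value `sInf ∅ = 0`
would break the forward direction. -/
theorem eta_le_iff {X Y : AddSubgroup G} (hXY : X ≤ Y) (hY : Y.FG) (k : ℕ) :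
    eta f X ≤ k ↔ ∀ m, k ≤ m → ∀ x ∈ X, f^[m + 1] x = 0 → f^[m] x = 0 := by
  simp only [eta, bijOn_iterate_image_iff]
  have hne : {k | ∀ m, k ≤ m → ∀ x ∈ X, f^[m + 1] x = 0 → f^[m] x = 0}.Nonempty :=
    (exists_ker_iterate_stable f hY).imp fun k hk m hm x hx => hk m hm x (hXY hx)
  exact ⟨fun h m hm => Nat.sInf_mem hne m (h.trans hm), fun h => Nat.sInf_le h⟩

end Eta

/-! ### The first Igusa-Todorov function -/

section IgusaTodorov

variable [IsArtinianRing Λ]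

theorem IsSummand.syz {Z M : FGModuleCat.{u} Λ} (h : IsSummand Z M) :
    IsSummand (syz Z) (syz M) :=
  h.elim fun Z' ⟨e⟩ => ⟨ArtinAlg.syz Z', syz_prod e⟩

theorem IsSummand.iterate_syz {Z M : FGModuleCat.{u} Λ} (h : IsSummand Z M) (n : ℕ) :
    IsSummand (ArtinAlg.syz^[n] Z) (ArtinAlg.syz^[n] M) := by
  induction n generalizing Z M with
  | zero => exact h
  | succ n ih => exact ih h.syz

theorem subsingleton_syz_iff (M : FGModuleCat.{u} Λ) : Subsingleton (syz M) ↔ M ∈ proj Λ := by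
  refine ⟨fun h => ?_, syz_projective⟩
  have := (coverMap_spec M).projective
  have hker : LinearMap.ker (coverMap M) = ⊥ := (Submodule.subsingleton_iff_eq_bot).1 h
  exact Module.Projective.of_equiv (LinearEquiv.ofBijective (coverMap M)
    ⟨LinearMap.ker_eq_bot.1 hker, (coverMap_spec M).surjective⟩)

/-- The class of `M` in `K_𝒫`. -/
noncomputable def clsBar (M : FGModuleCat.{u} Λ) : KP Λ := QuotientAddGroup.mk' (span (proj Λ)) (cls M)

theorem LP_clsBar (M : FGModuleCat.{u} Λ) : LP Λ (clsBar M) = clsBar (syz M) :=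
  congrArg (QuotientAddGroup.mk' (span (proj Λ))) (L_cls M)

theorem LP_iterate_clsBar (M : FGModuleCat.{u} Λ) (n : ℕ) :
    (LP Λ)^[n] (clsBar M) = clsBar (syz^[n] M) := by
  induction n generalizing M with
  | zero => rfl
  | succ n ih => rw [Function.iterate_succ_apply, Function.iterate_succ_apply, LP_clsBar, ih]

/-! ### Projectives are the modules with zero class in `K_𝒫` -/

/-- The length of `ΩM` is additive on direct sums and vanishes exactly on projectives, so it detects
projectivity from the class in `K` without unique decomposition into indecomposables. -/
theorem exists_lengthSyz (Λ : Type u) [Ring Λ] [IsArtinianRing Λ] :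
    ∃ l : K Λ →+ ℤ, ∀ M : FGModuleCat.{u} Λ, l (cls M) = (Module.length Λ (syz M)).toNat := by
  refine ⟨QuotientAddGroup.lift (splitRelations Λ)
    (FreeAbelianGroup.lift (Quotient.lift
      (fun M : FGModuleCat.{u} Λ => ((Module.length Λ (syz M)).toNat : ℤ))
      (fun _ _ ⟨e⟩ => (syz_congr e).elim fun e' => by rw [e'.length_eq]))) ?_,
    fun M => FreeAbelianGroup.lift_apply_of _ _⟩
  refine (AddSubgroup.closure_le _).2 ?_
  rintro _ ⟨M, X, Y, ⟨e⟩, rfl⟩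
  obtain ⟨e'⟩ := syz_prod e
  change FreeAbelianGroup.lift _ _ = 0
  rw [map_sub, map_sub, FreeAbelianGroup.lift_apply_of, FreeAbelianGroup.lift_apply_of,
    FreeAbelianGroup.lift_apply_of]
  change ((Module.length Λ (syz M)).toNat : ℤ) - (Module.length Λ (syz X)).toNat
    - (Module.length Λ (syz Y)).toNat = 0
  rw [e'.length_eq, Module.length_prod, ENat.toNat_add Module.length_ne_top Module.length_ne_top]
  push_cast
  ring

/-- The hypothesis concerns all summands, not just `M`, so that it passes to both factors of a
decomposition. -/
theorem cls_mem_span {𝒳 : Set (FGModuleCat.{u} Λ)} {M : FGModuleCat.{u} Λ}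
    (h : ∀ Z, IsSummand Z M → Z ∈ 𝒳) : cls M ∈ span 𝒳 := by
  induction M using decomposition_induction with
  | zero M hM => rw [cls_subsingleton M]; exact zero_mem _
  | indec M hM =>
    exact AddSubgroup.subset_closure
      ⟨M, hM, .inl (h M (.of_equiv (LinearEquiv.refl Λ M))), rfl⟩
  | prod M X Y e hX hY =>
    rw [cls_prod e]
    exact add_mem (hX fun Z hZ => h Z (hZ.trans (.of_prod_left e)))
      (hY fun Z hZ => h Z (hZ.trans (.of_prod_right e)))

/-- A module has class zero in `K_𝒫` exactly if it is projective. -/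
theorem clsBar_eq_zero_iff (M : FGModuleCat.{u} Λ) : clsBar M = 0 ↔ M ∈ proj Λ := by
  rw [clsBar, QuotientAddGroup.mk'_apply, QuotientAddGroup.eq_zero_iff]
  refine ⟨fun h => ?_, fun h => cls_mem_span fun Z hZ => proj_of_isSummand hZ h⟩
  obtain ⟨l, hl⟩ := exists_lengthSyz Λ
  have hle : span (proj Λ) ≤ l.ker := by
    rw [span, AddSubgroup.closure_le]
    rintro _ ⟨P, -, hP, rfl⟩
    have := syz_projective (P := P) (by simpa using hP)
    change l (cls P) = 0
    rw [hl, Module.length_eq_zero]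
    rfl
  have h0 : l (cls M) = 0 := hle h
  rw [hl] at h0
  have h1 : Module.length Λ (syz M) = 0 := by
    rw [← ENat.natCast_toNat (Module.length_ne_top (R := Λ) (M := syz M))]
    exact_mod_cast h0
  exact (subsingleton_syz_iff M).1 (Module.length_eq_zero_iff.1 h1)

/-- Indecomposable projectives die in `K_𝒫`, and an indecomposable summand of `X ^ s` is already a
summand of `X`. The remaining generators form a finite set, which makes `Φ` well defined. -/
theorem spanBar_eq_closure (X : FGModuleCat.{u} Λ) : spanBar X = AddSubgroup.closure
    {k | ∃ Z : FGModuleCat.{u} Λ, Indecomposable Z.obj ∧ IsSummand Z X ∧ k = clsBar Z} := by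
  refine (AddMonoidHom.map_closure _ _).trans ?_
  apply le_antisymm
  · rw [AddSubgroup.closure_le]
    rintro _ ⟨_, ⟨Z, hZ, hZX, rfl⟩, rfl⟩
    rcases hZX with h | h
    · exact AddSubgroup.subset_closure ⟨Z, hZ, isSummand_of_mem_add hZ h, rfl⟩
    · change clsBar Z ∈ AddSubgroup.closure _
      rw [(clsBar_eq_zero_iff Z).2 h]
      exact zero_mem _
  · rw [AddSubgroup.closure_le]
    rintro _ ⟨Z, hZ, hZX, rfl⟩
    exact AddSubgroup.subset_closure ⟨cls Z, ⟨Z, hZ, .inl (mem_add_of_isSummand hZX), rfl⟩, rfl⟩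

theorem spanBar_fg (X : FGModuleCat.{u} Λ) : (spanBar X).FG := by
  rw [AddSubgroup.fg_iff]
  refine ⟨_, (spanBar_eq_closure X).symm,
    ((finite_cls_indecomposable_summands X).image (QuotientAddGroup.mk' (span (proj Λ)))).subset ?_⟩
  rintro _ ⟨Z, hZ, hZX, rfl⟩
  exact ⟨cls Z, ⟨Z, hZ, hZX, rfl⟩, rfl⟩

theorem clsBar_mem_spanBar {Z X : FGModuleCat.{u} Λ} (h : IsSummand Z X) :
    clsBar Z ∈ spanBar X :=
  ⟨cls Z, cls_mem_span fun _ hZ' => mem_add_of_isSummand (hZ'.trans h), rfl⟩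

theorem LP_mem_spanBar {X : FGModuleCat.{u} Λ} {x : KP Λ} (hx : x ∈ spanBar X) :
    LP Λ x ∈ spanBar (syz X) := by
  suffices h : ∀ y ∈ spanBar X, y ∈ (spanBar (syz X)).comap (LP Λ) from h x hx
  change spanBar X ≤ (spanBar (syz X)).comap (LP Λ)
  rw [spanBar_eq_closure X, AddSubgroup.closure_le]
  rintro _ ⟨Z, -, hZX, rfl⟩
  change LP Λ (clsBar Z) ∈ spanBar (syz X)
  rw [LP_clsBar]
  exact clsBar_mem_spanBar hZX.syz

/-! ### `Φ` under syzygies -/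

theorem phi_le_iff (X : FGModuleCat.{u} Λ) (k : ℕ) : phi X ≤ k ↔
    ∀ m, k ≤ m → ∀ x ∈ spanBar X, (LP Λ)^[m + 1] x = 0 → (LP Λ)^[m] x = 0 :=
  eta_le_iff (LP Λ) le_rfl (spanBar_fg X) k

theorem phi_le_phi_syz_add_one (X : FGModuleCat.{u} Λ) : phi X ≤ phi (syz X) + 1 := by
  rw [phi_le_iff]
  rintro (_ | m) hm x hx h0
  · exact absurd hm (by lia)
  -- `L x` lies in `⟨ΩX⟩`, so stability there at `m` is stability for `x` at `m + 1`.
  · exact (phi_le_iff (syz X) _).1 le_rfl m (by lia) _ (LP_mem_spanBar hx) h0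

theorem phi_le_phi_iterate_syz_add (X : FGModuleCat.{u} Λ) (n : ℕ) :
    phi X ≤ phi (syz^[n] X) + n := by
  induction n generalizing X with
  | zero => rfl
  | succ n ih =>
    have h1 := phi_le_phi_syz_add_one X
    have h2 := ih (syz X)
    rw [Function.iterate_succ_apply]
    lia

/-! ### Projective dimension -/

/-- The short exact sequence `0 → Ω M → P → M → 0` of the projective cover. -/
noncomputable abbrev coverComplex (M : FGModuleCat.{u} Λ) : ShortComplex (ModuleCat.{u} Λ) :=
  (coverMap M).shortComplexKer

theorem coverComplex_shortExact (M : FGModuleCat.{u} Λ) : (coverComplex M).ShortExact :=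
  LinearMap.shortExact_shortComplexKer (coverMap_spec M).surjective

theorem coverObj_mem_proj (M : FGModuleCat.{u} Λ) : coverObj M ∈ proj Λ :=
  (coverMap_spec M).projective

instance (M : FGModuleCat.{u} Λ) : Projective (coverComplex M).X₂ :=
  (projective_obj_iff (coverObj M)).2 (coverObj_mem_proj M)

theorem hasProjectiveDimensionLE_iff (n : ℕ) (M : FGModuleCat.{u} Λ) :
    HasProjectiveDimensionLE M.obj n ↔ syz^[n] M ∈ proj Λ := by
  induction n generalizing M with
  | zero => exact (projective_iff_hasProjectiveDimensionLE_zero M.obj).symm.trans (projective_obj_iff M)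
  | succ n ih =>
    rw [Function.iterate_succ_apply, ← ih]
    exact (coverComplex_shortExact M).hasProjectiveDimensionLT_X₃_iff n inferInstance

theorem pd_lt_top_iff (M : FGModuleCat.{u} Λ) : pd M < ⊤ ↔ ∃ n, syz^[n] M ∈ proj Λ := by
  simp [pd, iInf_lt_iff, hasProjectiveDimensionLE_iff]

theorem pd_le_of_iterate_syz {M : FGModuleCat.{u} Λ} {n : ℕ} (h : syz^[n] M ∈ proj Λ) :
    pd M ≤ n :=
  iInf₂_le n ((hasProjectiveDimensionLE_iff n M).2 h)

theorem iterate_syz_phi_mem_proj {M : FGModuleCat.{u} Λ} (h : pd M < ⊤) :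
    syz^[phi M] M ∈ proj Λ := by
  obtain ⟨n, hn⟩ := (pd_lt_top_iff M).1 h
  -- Descent: the class of `M` lies in `⟨M⟩`, and from `Φ(M)` on a vanishing iterate of `L` forces
  -- the previous one to vanish.
  have key : ∀ j, syz^[phi M + j] M ∈ proj Λ → syz^[phi M] M ∈ proj Λ := by
    intro j
    induction j with
    | zero => exact id
    | succ j ih =>
      intro hj
      apply ih
      rw [← clsBar_eq_zero_iff, ← LP_iterate_clsBar] at hj ⊢
      exact (phi_le_iff M _).1 le_rfl _ (by lia) _
        (clsBar_mem_spanBar (.of_equiv (LinearEquiv.refl Λ M))) hj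
  have hstep : ∀ j, syz^[n + j] M ∈ proj Λ := by
    intro j
    induction j with
    | zero => exact hn
    | succ j ih =>
      rw [← add_assoc, Function.iterate_succ_apply', ← clsBar_eq_zero_iff, ← LP_clsBar,
        (clsBar_eq_zero_iff _).2 ih, map_zero]
  exact key n (by rw [add_comm]; exact hstep _)

theorem pd_le_phi {M : FGModuleCat.{u} Λ} (h : pd M < ⊤) : pd M ≤ phi M :=
  pd_le_of_iterate_syz (iterate_syz_phi_mem_proj h)

theorem finDim_le_phiDim (𝒳 : Set (FGModuleCat.{u} Λ)) : finDim 𝒳 ≤ phiDim 𝒳 :=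
  iSup₂_le fun M hM => (pd_le_phi hM.2).trans (le_iSup₂ (f := fun X (_ : X ∈ 𝒳) => (phi X : ℕ∞))
    M hM.1)

theorem phiDim_le_psiDim (𝒳 : Set (FGModuleCat.{u} Λ)) : phiDim 𝒳 ≤ psiDim 𝒳 :=
  iSup₂_mono fun _ _ => le_self_add

end IgusaTodorov

/-! ### Left saturated classes and syzygies -/

namespace LeftSaturated

variable {𝒟 : Set (FGModuleCat.{u} Λ)} (h𝒟 : LeftSaturated 𝒟)

include h𝒟

theorem congr {X Y : FGModuleCat.{u} Λ} (hX : X ∈ 𝒟) (e : Y ≃ₗ[Λ] X) : Y ∈ 𝒟 :=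
  h𝒟.summands Y X hX (.of_equiv e)

theorem prod {M X Y : FGModuleCat.{u} Λ} (hX : X ∈ 𝒟) (hY : Y ∈ 𝒟) (e : M ≃ₗ[Λ] X × Y) :
    M ∈ 𝒟 := by
  refine h𝒟.congr (h𝒟.extensions X (FGModuleCat.of Λ (X × Y)) Y (LinearMap.inl Λ X Y)
    (LinearMap.snd Λ X Y) ⟨LinearMap.inl_injective, .inl_snd, LinearMap.snd_surjective⟩ hX hY) e

end LeftSaturated

theorem IsShortExact.nonempty_equiv_prod {A B P : FGModuleCat.{u} Λ} {f : A →ₗ[Λ] B}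
    {g : B →ₗ[Λ] P} (h : IsShortExact f g) (hP : P ∈ proj Λ) : Nonempty (B ≃ₗ[Λ] A × P) := by
  have : Module.Projective Λ P := hP
  exact ⟨(h.exact.splitSurjectiveEquiv h.injective
    ⟨_, (Module.projective_lifting_property g LinearMap.id h.surjective).choose_spec⟩).1⟩

/-- An infimum of naturals in `ℕ∞` lying below `k + 1` has a witness below `k + 1`, hence at most
`k`. -/
theorem subsingleton_ext_of_relId_le {𝒳 : Set (FGModuleCat.{u} Λ)} {X N : FGModuleCat.{u} Λ}
    {k j : ℕ} (h : relId 𝒳 N ≤ k) (hX : X ∈ 𝒳) (hj : k < j) :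
    Subsingleton (Abelian.Ext X.obj N.obj j) := by
  have h' : relId 𝒳 N < (k + 1 : ℕ) := h.trans_lt (by exact_mod_cast Nat.lt_succ_self k)
  simp only [relId, iInf_lt_iff, Nat.cast_lt] at h'
  obtain ⟨m, hm, hmk⟩ := h'
  exact hm j (by lia) X hX

variable [IsArtinianRing Λ]

/-! ### Short exact sequences built from projective covers -/

theorem coverMap_isShortExact (M : FGModuleCat.{u} Λ) :
    IsShortExact (A := syz M) (LinearMap.ker (coverMap M)).subtype (coverMap M) :=
  ⟨Submodule.subtype_injective _, LinearMap.exact_subtype_ker_map _, (coverMap_spec M).surjective⟩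

/-- A short exact sequence `0 → X → Y → Z → 0` and the projective cover `P → Z` give a short exact
sequence `0 → Ω Z → X × P → Y → 0`. -/
theorem IsShortExact.rotate {X Y Z : FGModuleCat.{u} Λ} {f : X →ₗ[Λ] Y} {g : Y →ₗ[Λ] Z}
    (h : IsShortExact f g) :
    ∃ (a : syz Z →ₗ[Λ] FGModuleCat.of Λ (X × coverObj Z))
      (b : FGModuleCat.of Λ (X × coverObj Z) →ₗ[Λ] Y), IsShortExact a b := by
  have := (coverMap_spec Z).projective
  obtain ⟨t, ht⟩ := Module.projective_lifting_property g (coverMap Z) h.surjective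
  have ht' : ∀ p, g (t p) = coverMap Z p := fun p => LinearMap.congr_fun ht p
  have hker : ∀ s : LinearMap.ker (coverMap Z), t s.1 ∈ LinearMap.range f := fun s =>
    (h.exact _).1 ((ht' s.1).trans s.2)
  let e := LinearEquiv.ofInjective f h.injective
  -- On `ΩZ` the lift `t` lands in the image of `f`, and `c` is its unique factorization through
  -- `f`. The kernel of `(x, p) ↦ f x + t p` is then the set of pairs `(c s, -s)`.
  let c : syz Z →ₗ[Λ] X := e.symm.toLinearMap ∘ₗ
    LinearMap.codRestrict (LinearMap.range f) (t ∘ₗ (LinearMap.ker (coverMap Z)).subtype) hker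
  have hc : ∀ s : LinearMap.ker (coverMap Z), f (c s) = t s.1 := fun s =>
    congrArg Subtype.val (e.apply_symm_apply ⟨t s.1, hker s⟩)
  refine ⟨LinearMap.prod c (-(LinearMap.ker (coverMap Z)).subtype), LinearMap.coprod f t,
    ⟨?_, ?_, ?_⟩⟩
  · intro s s' hs
    have h2 : -(s.1) = -(s'.1) := congrArg Prod.snd hs
    exact Subtype.ext (neg_injective h2)
  · rintro ⟨x, p⟩
    change f x + t p = 0 ↔ _
    constructor
    · intro h0
      have hp : -p ∈ LinearMap.ker (coverMap Z) := by
        rw [LinearMap.mem_ker, ← ht', map_neg, ← eq_neg_of_add_eq_zero_left h0]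
        exact (h.exact _).2 ⟨x, rfl⟩
      refine ⟨⟨-p, hp⟩, Prod.ext (h.injective ?_) (neg_neg p)⟩
      change f (c ⟨-p, hp⟩) = f x
      rw [hc, eq_neg_of_add_eq_zero_left h0, map_neg]
    · rintro ⟨s, hs⟩
      have h1 : c s = x := congrArg Prod.fst hs
      have h2 : -s.1 = p := congrArg Prod.snd hs
      rw [← h1, ← h2, map_neg]
      exact add_neg_eq_zero.2 (hc s)
  · intro y
    obtain ⟨p, hp⟩ := (coverMap_spec Z).surjective (g y)
    obtain ⟨x, hx⟩ := (h.exact (y - t p)).1 (by rw [map_sub, ht', hp, sub_self])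
    refine ⟨(x, p), ?_⟩
    change f x + t p = y
    rw [hx, sub_add_cancel]

/-- Schanuel's lemma. -/
theorem IsShortExact.schanuel {S P C : FGModuleCat.{u} Λ} {f : S →ₗ[Λ] P} {g : P →ₗ[Λ] C}
    (h : IsShortExact f g) (hP : P ∈ proj Λ) : Nonempty ((S × coverObj C) ≃ₗ[Λ] syz C × P) := by
  obtain ⟨a, b, hab⟩ := h.rotate
  exact hab.nonempty_equiv_prod hP

/-- The composite `P → B → C` vanishes on exactly those elements that `q` sends into `A`, giving `0
→ ker q → ker (g ∘ q) → A → 0`. -/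
theorem IsShortExact.ker_comp {A B C P : FGModuleCat.{u} Λ} {f : A →ₗ[Λ] B} {g : B →ₗ[Λ] C}
    (h : IsShortExact f g) (q : P →ₗ[Λ] B) (hq : Function.Surjective q) :
    ∃ (a : FGModuleCat.of Λ (LinearMap.ker q) →ₗ[Λ] FGModuleCat.of Λ (LinearMap.ker (g ∘ₗ q)))
      (b : FGModuleCat.of Λ (LinearMap.ker (g ∘ₗ q)) →ₗ[Λ] A), IsShortExact a b := by
  let e := LinearEquiv.ofInjective f h.injective
  have hr : ∀ s : LinearMap.ker (g ∘ₗ q), q s.1 ∈ LinearMap.range f := fun s => (h.exact _).1 s.2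
  let b : LinearMap.ker (g ∘ₗ q) →ₗ[Λ] A := e.symm.toLinearMap ∘ₗ
    LinearMap.codRestrict (LinearMap.range f) (q ∘ₗ (LinearMap.ker (g ∘ₗ q)).subtype) hr
  have hb : ∀ s : LinearMap.ker (g ∘ₗ q), f (b s) = q s.1 := fun s =>
    congrArg Subtype.val (e.apply_symm_apply ⟨q s.1, hr s⟩)
  refine ⟨Submodule.inclusion (LinearMap.ker_le_ker_comp q g), b,
    ⟨Submodule.inclusion_injective _, ?_, ?_⟩⟩
  · intro s
    constructor
    · intro h0
      have h1 : q s.1 = 0 := by rw [← hb, h0, map_zero]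
      exact ⟨⟨s.1, h1⟩, rfl⟩
    · rintro ⟨⟨p, hp⟩, rfl⟩
      apply h.injective
      rw [map_zero]
      exact (hb _).trans hp
  · intro a
    obtain ⟨p, hp⟩ := hq (f a)
    refine ⟨⟨p, ?_⟩, h.injective ((hb _).trans hp)⟩
    rw [LinearMap.mem_ker, LinearMap.comp_apply, hp]
    exact (h.exact _).2 ⟨a, rfl⟩

theorem iterate_syz_prod (n : ℕ) {M X Y : FGModuleCat.{u} Λ} (e : M ≃ₗ[Λ] X × Y) :
    Nonempty (syz^[n] M ≃ₗ[Λ] syz^[n] X × syz^[n] Y) := by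
  induction n generalizing M X Y with
  | zero => exact ⟨e⟩
  | succ n ih => exact (syz_prod e).elim ih

namespace LeftSaturated

variable {𝒟 : Set (FGModuleCat.{u} Λ)} (h𝒟 : LeftSaturated 𝒟)

include h𝒟

theorem syz_mem {M : FGModuleCat.{u} Λ} (hM : M ∈ 𝒟) : syz M ∈ 𝒟 :=
  h𝒟.kernels _ _ _ _ _ (coverMap_isShortExact M) (h𝒟.projectives (coverObj_mem_proj M)) hM

theorem iterate_syz_mem {M : FGModuleCat.{u} Λ} (hM : M ∈ 𝒟) (n : ℕ) : syz^[n] M ∈ 𝒟 := by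
  induction n generalizing M with
  | zero => exact hM
  | succ n ih => exact ih (h𝒟.syz_mem hM)

theorem iterate_syz_mem_of_le {M : FGModuleCat.{u} Λ} {m n : ℕ} (hmn : m ≤ n)
    (hM : syz^[m] M ∈ 𝒟) : syz^[n] M ∈ 𝒟 := by
  obtain ⟨j, rfl⟩ := Nat.exists_eq_add_of_le' hmn
  rw [Function.iterate_add_apply]
  exact h𝒟.iterate_syz_mem hM j

theorem iterate_syz_mem_of_isSummand (n : ℕ) {Z M : FGModuleCat.{u} Λ} (hM : syz^[n] M ∈ 𝒟)
    (h : IsSummand Z M) : syz^[n] Z ∈ 𝒟 :=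
  h𝒟.summands _ _ hM (h.iterate_syz n)

theorem iterate_syz_mem_of_prod_proj (n : ℕ) {M X P : FGModuleCat.{u} Λ}
    (hX : syz^[n] X ∈ 𝒟) (hP : P ∈ proj Λ) (e : M ≃ₗ[Λ] X × P) : syz^[n] M ∈ 𝒟 := by
  obtain ⟨e'⟩ := iterate_syz_prod n e
  exact h𝒟.prod hX (h𝒟.iterate_syz_mem (h𝒟.projectives hP) n) e'

/-- The modules with `n`-th syzygy in `𝒟` are closed under kernels of epimorphisms. -/
theorem iterate_syz_mem_of_isShortExact (n : ℕ) {A B C : FGModuleCat.{u} Λ} {f : A →ₗ[Λ] B}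
    {g : B →ₗ[Λ] C} (h : IsShortExact f g) (hB : syz^[n] B ∈ 𝒟) (hC : syz^[n] C ∈ 𝒟) :
    syz^[n] A ∈ 𝒟 := by
  induction n generalizing A B C with
  | zero => exact h𝒟.kernels _ _ _ f g h hB hC
  | succ n ih =>
    -- `S` is a syzygy of `C` up to projectives. From `0 → ΩB → S → A → 0` rotation gives `0 → ΩA →
    -- ΩB × P_A → S → 0`, and Schanuel compares `S` with `ΩC`, so the induction hypothesis applies.
    let S := FGModuleCat.of Λ (LinearMap.ker (g ∘ₗ coverMap B))
    obtain ⟨a, b, hab⟩ := h.ker_comp (coverMap B) (coverMap_spec B).surjective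
    obtain ⟨a', b', hab'⟩ := hab.rotate
    have hS : IsShortExact (A := S) (LinearMap.ker (g ∘ₗ coverMap B)).subtype (g ∘ₗ coverMap B) :=
      ⟨Submodule.subtype_injective _, LinearMap.exact_subtype_ker_map _,
        h.surjective.comp (coverMap_spec B).surjective⟩
    obtain ⟨e⟩ := hS.schanuel (coverObj_mem_proj B)
    refine ih hab' ?_ ?_
    · exact h𝒟.iterate_syz_mem_of_prod_proj n (X := syz B) (P := coverObj A) hB
        (coverObj_mem_proj A) (LinearEquiv.refl _ _)
    · exact h𝒟.iterate_syz_mem_of_isSummand n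
        (h𝒟.iterate_syz_mem_of_prod_proj n (M := FGModuleCat.of Λ (S × coverObj C)) (X := syz C)
          (P := coverObj B) hC (coverObj_mem_proj B) e)
        (.of_prod_left (Y := coverObj C) (LinearEquiv.refl _ _))

/-- Rotating `0 → K → X → M → 0` exhibits `ΩM` as the kernel of an epimorphism `K × P → X` between
modules whose `n`-th syzygies are in `𝒟`. -/
theorem iterate_syz_mem_of_hasResolution {n : ℕ} {M : FGModuleCat.{u} Λ}
    (h : HasResolution 𝒟 n M) : syz^[n] M ∈ 𝒟 := by
  induction h with
  | zero hX e => exact h𝒟.congr hX e.symm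
  | @succ n K X M f g hfg hX hK ih =>
    obtain ⟨a, b, hab⟩ := hfg.rotate
    exact h𝒟.iterate_syz_mem_of_isShortExact n hab
      (h𝒟.iterate_syz_mem_of_prod_proj n (X := K) (P := coverObj M) ih
        (coverObj_mem_proj M) (LinearEquiv.refl _ _))
      (h𝒟.iterate_syz_mem hX n)

theorem exists_iterate_syz_mem_of_resdim_lt_top {M : FGModuleCat.{u} Λ}
    (h : resdim 𝒟 M < ⊤) : ∃ n, syz^[n] M ∈ 𝒟 := by
  simp only [resdim, iInf_lt_iff] at h
  obtain ⟨n, hn, -⟩ := h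
  exact ⟨n, h𝒟.iterate_syz_mem_of_hasResolution hn⟩

theorem iterate_syz_mem_of_resdim_le {n : ℕ} {M : FGModuleCat.{u} Λ}
    (h : resdim 𝒟 M ≤ n) : syz^[n] M ∈ 𝒟 := by
  have h' : resdim 𝒟 M < (n + 1 : ℕ) := h.trans_lt (by exact_mod_cast Nat.lt_succ_self n)
  simp only [resdim, iInf_lt_iff, Nat.cast_lt] at h'
  obtain ⟨m, hm, hmn⟩ := h'
  exact h𝒟.iterate_syz_mem_of_le (by lia) (h𝒟.iterate_syz_mem_of_hasResolution hm)

/-! ### Bounding `Ψ` by syzygies in `𝒟` -/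

theorem psi_le (hΦ : ∀ X ∈ 𝒟, phi X = 0) {k : ℕ} {M : FGModuleCat.{u} Λ}
    (hM : syz^[k] M ∈ 𝒟) : psi M ≤ k := by
  have hp : phi M ≤ k := by simpa [hΦ _ hM] using phi_le_phi_iterate_syz_add M k
  obtain ⟨j, hj⟩ := Nat.exists_eq_add_of_le hp
  have hfin : finDim {Z | IsSummand Z (syz^[phi M] M)} ≤ j := by
    refine iSup₂_le fun Z ⟨hZ, hpd⟩ => pd_le_of_iterate_syz ?_
    have hZ𝒟 : syz^[j] Z ∈ 𝒟 := by
      refine h𝒟.summands _ _ hM ?_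
      rw [hj, add_comm, Function.iterate_add_apply]
      exact hZ.iterate_syz j
    have hpd' : pd (syz^[j] Z) < ⊤ := by
      obtain ⟨n, hn⟩ := (pd_lt_top_iff Z).1 hpd
      refine (pd_lt_top_iff _).2 ⟨n, ?_⟩
      rw [← Function.iterate_add_apply, add_comm, Function.iterate_add_apply,
        ← clsBar_eq_zero_iff, ← LP_iterate_clsBar, (clsBar_eq_zero_iff _).2 hn, iterate_map_zero]
    -- `Φ(Ω^j Z) = 0`, so finite projective dimension means projective.
    simpa [hΦ _ hZ𝒟] using iterate_syz_phi_mem_proj hpd'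
  calc psi M ≤ (phi M : ℕ∞) + j := add_le_add le_rfl hfin
    _ = k := by rw [hj]; push_cast; rfl

/-- Common core of both bounds, with `d` the resolution dimension or `id(ω)`; only finite `d` needs
an argument. -/
theorem psiDim_le (hΦ : phiDim 𝒟 = 0) (n : ℕ) {d : ℕ∞}
    (hd : ∀ k : ℕ, d = k → ∀ M : FGModuleCat.{u} Λ, syz^[k] (syz^[n] M) ∈ 𝒟) :
    psiDim (modCls Λ) ≤ d + n := by
  have hΦ' : ∀ X ∈ 𝒟, phi X = 0 := fun X hX => by
    have h : (phi X : ℕ∞) ≤ phiDim 𝒟 := le_iSup₂ (f := fun X (_ : X ∈ 𝒟) => (phi X : ℕ∞)) X hX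
    rw [hΦ] at h
    exact_mod_cast nonpos_iff_eq_zero.1 h
  cases d with
  | top => simp
  | coe k =>
    refine iSup₂_le fun M _ => ?_
    have h := hd k rfl M
    rw [← Function.iterate_add_apply] at h
    exact_mod_cast h𝒟.psi_le hΦ' h

theorem psiDim_le_resdimClass_add (hΦ : phiDim 𝒟 = 0) (n : ℕ) :
    psiDim (modCls Λ) ≤ resdimClass 𝒟 (syz^[n] '' modCls Λ) + n := by
  refine h𝒟.psiDim_le hΦ n fun k hk M => h𝒟.iterate_syz_mem_of_resdim_le ?_
  rw [← hk]
  exact le_iSup₂ (f := fun N (_ : N ∈ syz^[n] '' modCls Λ) => resdim 𝒟 N) _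
    (Set.mem_image_of_mem _ (Set.mem_univ M))

end LeftSaturated

/-! ### Relative cogenerators -/

open Abelian

/-- Dimension shift: in the long exact sequence `Ext^{n+1}(ΩM, N)` sits between `Ext^{n+1}(P, N) =
0` and `Ext^{n+2}(M, N) = 0`. -/
theorem subsingleton_ext_syz (M N : FGModuleCat.{u} Λ) {n : ℕ}
    (h : Subsingleton (Ext M.obj N.obj (n + 2))) :
    Subsingleton (Ext (syz M).obj N.obj (n + 1)) := by
  refine subsingleton_of_forall_eq 0 fun x => ?_
  obtain ⟨y, hy⟩ := Ext.contravariant_sequence_exact₁ (coverComplex_shortExact M) N.obj x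
    (add_comm 1 (n + 1)) (Subsingleton.elim (α := Ext M.obj N.obj (n + 2)) _ _)
  rw [← hy, Ext.eq_zero_of_projective y, Ext.comp_zero]
  rfl

theorem subsingleton_ext_iterate_syz (M N : FGModuleCat.{u} Λ) {n k : ℕ}
    (h : Subsingleton (Ext M.obj N.obj (n + k + 1))) :
    Subsingleton (Ext (syz^[k] M).obj N.obj (n + 1)) := by
  induction k generalizing M with
  | zero => exact h
  | succ k ih => exact ih (syz M) (subsingleton_ext_syz M N h)

theorem exists_extension_of_subsingleton_ext (M N : FGModuleCat.{u} Λ)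
    (h : Subsingleton (Ext M.obj N.obj 1)) (f : syz M →ₗ[Λ] N) :
    ∃ g : coverObj M →ₗ[Λ] N, g ∘ₗ (LinearMap.ker (coverMap M)).subtype = f := by
  obtain ⟨y, hy⟩ := Ext.contravariant_sequence_exact₁ (coverComplex_shortExact M) N.obj
    (Ext.mk₀ (ModuleCat.ofHom f)) (add_comm 1 0) (Subsingleton.elim (α := Ext M.obj N.obj 1) _ _)
  obtain ⟨g, rfl⟩ := Ext.homEquiv₀.symm.surjective y
  rw [Ext.homEquiv₀_symm_apply, Ext.mk₀_comp_mk₀] at hy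
  have := Ext.homEquiv₀.symm.injective hy
  exact ⟨g.hom, congrArg ModuleCat.Hom.hom this⟩

/-- If `Ω M → W` is the inclusion of a cokernel `X'` and extends to the projective cover `P` of
`M`, then `0 → P → W × M → X' → 0` is exact. -/
theorem exists_isShortExact_prod {M W X' : FGModuleCat.{u} Λ} {f : syz M →ₗ[Λ] W}
    {g : W →ₗ[Λ] X'} (h : IsShortExact f g) (q : coverObj M →ₗ[Λ] W)
    (hq : q ∘ₗ (LinearMap.ker (coverMap M)).subtype = f) :
    ∃ (a : coverObj M →ₗ[Λ] FGModuleCat.of Λ (W × M))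
      (b : FGModuleCat.of Λ (W × M) →ₗ[Λ] X'), IsShortExact a b := by
  have hq' : ∀ s : LinearMap.ker (coverMap M), q s.1 = f s := fun s => LinearMap.congr_fun hq s
  have hle : LinearMap.ker (coverMap M) ≤ LinearMap.ker (g ∘ₗ q) := fun p hp => by
    rw [LinearMap.mem_ker, LinearMap.comp_apply, hq' ⟨p, hp⟩]
    exact (h.exact _).2 ⟨_, rfl⟩
  let e := (coverMap M).quotKerEquivOfSurjective (coverMap_spec M).surjective
  let r : M →ₗ[Λ] X' := (LinearMap.ker (coverMap M)).liftQ (g ∘ₗ q) hle ∘ₗ e.symm.toLinearMap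
  have hr : ∀ p, r (coverMap M p) = g (q p) := fun p => by
    have : e.symm (coverMap M p) = Submodule.Quotient.mk p := by
      rw [LinearEquiv.symm_apply_eq]; rfl
    simp [r, this]
  refine ⟨LinearMap.prod q (coverMap M), LinearMap.coprod g (-r), ⟨?_, ?_, ?_⟩⟩
  · rw [← LinearMap.ker_eq_bot, LinearMap.ker_eq_bot']
    intro p hp
    have h1 : q p = 0 := congrArg Prod.fst hp
    have h2 : coverMap M p = 0 := congrArg Prod.snd hp
    have h3 := hq' ⟨p, h2⟩
    have h4 := h.injective ((h3.symm.trans h1).trans (map_zero f).symm)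
    exact congrArg Subtype.val h4
  · rintro ⟨w, m⟩
    change g w + -r m = 0 ↔ _
    constructor
    · intro h0
      obtain ⟨p, rfl⟩ := (coverMap_spec M).surjective m
      -- The preimage `p` of `m` is only determined up to `ΩM`; the correction `s` adjusts its image
      -- in `W` to `w`.
      obtain ⟨s, hs⟩ := (h.exact (w - q p)).1 (by rw [map_sub, ← hr, sub_eq_add_neg, h0])
      refine ⟨p + s.1, Prod.ext ?_ ?_⟩
      · change q (p + s.1) = w
        rw [map_add, (hq' s).trans hs, add_sub_cancel]
      · change coverMap M (p + s.1) = coverMap M p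
        rw [map_add, LinearMap.mem_ker.1 s.2, add_zero]
    · rintro ⟨p, hp⟩
      have h1 : q p = w := congrArg Prod.fst hp
      have h2 : coverMap M p = m := congrArg Prod.snd hp
      rw [← h1, ← h2, hr, add_neg_cancel]
  · intro x
    obtain ⟨w, rfl⟩ := h.surjective x
    refine ⟨(w, 0), ?_⟩
    change g w + -r 0 = g w
    rw [map_zero, neg_zero, add_zero]

namespace LeftSaturated

variable {𝒟 : Set (FGModuleCat.{u} Λ)} (h𝒟 : LeftSaturated 𝒟)

include h𝒟

/-- Embed `ΩM` into some `W ∈ ω` with cokernel `X' ∈ 𝒟`. Vanishing of `Ext¹(M, W)` extends the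
embedding to the cover `P`, so `W × M` is an extension of `X'` by `P` and lies in `𝒟`, and so does
its summand `M`. -/
theorem mem_of_syz_mem {ω : Set (FGModuleCat.{u} Λ)} (hω : IsRelCogenerator 𝒟 ω)
    {M : FGModuleCat.{u} Λ} (hM : syz M ∈ 𝒟)
    (hext : ∀ W ∈ ω, Subsingleton (Ext M.obj W.obj 1)) : M ∈ 𝒟 := by
  obtain ⟨W, hW, X', hX', f, g, hfg⟩ := hω.2 _ hM
  obtain ⟨q, hq⟩ := exists_extension_of_subsingleton_ext M W (hext W hW) f
  obtain ⟨a, b, hab⟩ := exists_isShortExact_prod hfg q hq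
  exact h𝒟.summands M _
    (h𝒟.extensions _ _ _ a b hab (h𝒟.projectives (coverObj_mem_proj M)) hX')
    (.of_prod_right (X := W) (LinearEquiv.refl _ _))

theorem iterate_syz_mem_of_idClass_le {ω : Set (FGModuleCat.{u} Λ)} (hω : IsRelCogenerator 𝒟 ω)
    {k : ℕ} (hk : idClass ω ≤ k) {M : FGModuleCat.{u} Λ} (hM : resdim 𝒟 M < ⊤) :
    syz^[k] M ∈ 𝒟 := by
  obtain ⟨n, hn⟩ := h𝒟.exists_iterate_syz_mem_of_resdim_lt_top hM
  have key : ∀ j, syz^[k + j] M ∈ 𝒟 → syz^[k] M ∈ 𝒟 := by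
    intro j
    induction j with
    | zero => exact id
    | succ j ih =>
      intro hj
      rw [← add_assoc, Function.iterate_succ_apply'] at hj
      -- By dimension shift `Ext¹(Ω^{k+j} M, W)` vanishes once `Ext^{k+j+1}(M, W)` does, and `k + j
      -- + 1` exceeds the injective dimension of `W`.
      refine ih (h𝒟.mem_of_syz_mem hω hj fun W hW => subsingleton_ext_iterate_syz (n := 0) M W ?_)
      refine subsingleton_ext_of_relId_le (𝒳 := Set.univ) (k := k) ?_ (Set.mem_univ _) (by lia)
      exact (le_iSup₂ (f := fun N (_ : N ∈ ω) => relId Set.univ N) W hW).trans hk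
  exact key n (h𝒟.iterate_syz_mem_of_le (by lia) hn)

theorem psiDim_le_idClass_add (hΦ : phiDim 𝒟 = 0) (n : ℕ) {ω : Set (FGModuleCat.{u} Λ)}
    (hω : IsRelCogenerator 𝒟 ω) (hn : syz^[n] '' modCls Λ ⊆ wedge 𝒟) :
    psiDim (modCls Λ) ≤ idClass ω + n :=
  h𝒟.psiDim_le hΦ n fun _ hk M => h𝒟.iterate_syz_mem_of_idClass_le hω hk.le
    (hn (Set.mem_image_of_mem _ (Set.mem_univ M)))

end LeftSaturated

end ArtinAlg

theorem theorem4 {Λ : Type u} [Ring Λ] [ArtinAlg.IsArtinAlgebra Λ] (n : ℕ)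
    (𝒟 : Set (FGModuleCat.{u} Λ)) (h𝒟 : ArtinAlg.LeftSaturated 𝒟)
    (hΦ : ArtinAlg.phiDim 𝒟 = 0) :
    (ArtinAlg.finDim (ArtinAlg.modCls Λ) ≤ ArtinAlg.phiDim (ArtinAlg.modCls Λ) ∧
      ArtinAlg.phiDim (ArtinAlg.modCls Λ) ≤ ArtinAlg.psiDim (ArtinAlg.modCls Λ) ∧
      ArtinAlg.psiDim (ArtinAlg.modCls Λ) ≤
        ArtinAlg.resdimClass 𝒟 (ArtinAlg.syz^[n] '' ArtinAlg.modCls Λ) + n) ∧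
    (∀ ω : Set (FGModuleCat.{u} Λ), ArtinAlg.ClosedUnderSummands ω →
      ArtinAlg.IsRelInjective 𝒟 ω → ArtinAlg.IsRelCogenerator 𝒟 ω →
      ArtinAlg.syz^[n] '' ArtinAlg.modCls Λ ⊆ ArtinAlg.wedge 𝒟 →
      ArtinAlg.finDim (ArtinAlg.modCls Λ) ≤ ArtinAlg.phiDim (ArtinAlg.modCls Λ) ∧
      ArtinAlg.phiDim (ArtinAlg.modCls Λ) ≤ ArtinAlg.psiDim (ArtinAlg.modCls Λ) ∧
      ArtinAlg.psiDim (ArtinAlg.modCls Λ) ≤ ArtinAlg.idClass ω + n) :=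
  ⟨⟨ArtinAlg.finDim_le_phiDim _, ArtinAlg.phiDim_le_psiDim _, h𝒟.psiDim_le_resdimClass_add hΦ n⟩,
    fun _ _ _ hω hn => ⟨ArtinAlg.finDim_le_phiDim _, ArtinAlg.phiDim_le_psiDim _,
      h𝒟.psiDim_le_idClass_add hΦ n hω hn⟩⟩
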